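/- Let $n\ge 0$ be an integer and let $\mathbb R_n$ be the real Clifford algebra with units $e_1,\dots,e_n$ ($e_i^2=-1$, $e_ie_j=-e_je_i$ for $i\ne j$), $e_0=1$, with the Euclidean norm $|y|^2=\sum_A y_A^2$ of the coordinates in the basis $e_A=e_{i_1}\cdots e_{i_r}$, $A=\{i_1<\dots<i_r\}$. Identify $x=(x_0,\dots,x_n)\in\mathbb R^{n+1}$ with the paravector $x_0+x_1e_1+\dots+x_ne_n$. A $C^1$ function $f:\mathbb R^{n+1}\to\mathbb R_n$ is entire left monogenic if $\partial_{x_0}f+\sum_{i=1}^n e_i\partial_{x_i}f=0$. For $\sigma>0$ let $A_{1,\sigma}$ be the space of entire left monogenic $f$ with $\|f\|_{1,\sigma}=\sup_x|f(x)|e^{-\sigma|x|}<\infty$; $f_N\to f$ in $A_1$ means that for some $\sigma>0$ all $f_N$ and $f$ lie in $A_{1,\sigma}$ and $\|f_N-f\|_{1,\sigma}\to0$. The monogenic exponential is $$E(x)=\sum_{k=0}^\infty\frac1{k!}\sum_{\ell_1,\dots,\ell_k=1}^n\Big(\frac1{k!}\sum_{\sigma\in S_k}z_{\ell_{\sigma(1)}}\cdots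 z_{\ell_{\sigma(k)}}\Big)e_{\ell_1}\cdots e_{\ell_k},\qquad z_i=x_i-x_0e_i,$$ the Cauchy--Kowalewski extension of $e^{x_1e_1+\dots+x_ne_n}$. A sequence $\sum_{j=0}^N Z_j(N)E(e_0x_0h_{j,0}(N)+\dots+e_nx_nh_{j,n}(N))$, $N\in\mathbb N$, with $Z_j(N)\in\mathbb R_n$ and $h_{j,\ell}(N)\in\mathbb R$, is called superoscillating at $a\in\mathbb R$ with limit frequencies $g_0(a),\dots,g_n(a)$ if $|h_{j,\ell}(N)|\le1$ for all $N$, all $0\le j\le N$ and all $0\le\ell\le n$, the functions $g_0,\dots,g_n:\mathbb R\to\mathbb R$ are continuous, $|g_\ell(a)|>1$ for $\ell=1,\dots,n$, and the sequence converges, uniformly in $x$ on every compact subset of $\mathbb R^{n+1}$, to $E(e_0x_0g_0(a)+\dots+e_nx_ng_n(a))$. Theorem. Let $g_k(t)=\sum_{l=0}^\infty g_{k,l}t^l$ ($k=0,\dots,n$) be real power series converging for every $t\in\mathbb R$, with $|g_k(t)|>1$ for $|t|>1$ and $|g_k(t)|\le1$ for $|t|\le1$. Let $a\in\mathbb R$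 and, for $N\in\mathbb N$ and $0\le j\le N$, let $h_j(N)\in[-1,1]$ and $Z_j(N)\in\mathbb R_n$. Suppose that $f_N(x)=\sum_{j=0}^N E(h_j(N)x)Z_j(N)$ converges to $x\mapsto E(ax)$ in $A_1$. Put $u_l(x)=e_0x_0g_{0,l}+\dots+e_nx_ng_{n,l}$. Then: 1. for all $x\in\mathbb R^{n+1}$ and $t\in\mathbb R$, $\sum_{l=0}^\infty u_l(x)t^l=e_0x_0g_0(t)+\dots+e_nx_ng_n(t)$, so that $$F_N(x):=\sum_{j=0}^N Z_j(N)E\Big(\sum_{l=0}^\infty u_l(x)h_j(N)^l\Big)=\sum_{j=0}^N Z_j(N)E\big(e_0x_0g_0(h_j(N))+\dots+e_nx_ng_n(h_j(N))\big);$$ 2. $F_N(x)$ converges to $E(e_0x_0g_0(a)+\dots+e_nx_ng_n(a))$ uniformly on every compact subset of $\mathbb R^{n+1}$; 3. if $|a|>1$, then $(F_N)$ is superoscillating at $a$ with limit frequencies $g_0(a),\dots,g_n(a)$. -/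

import Mathlib

open Filter Topology

noncomputable section

namespace Cliff

/-! ### The real Clifford algebra on `n` imaginary units -/

/-- The quadratic form `v ↦ -(v₁² + … + vₙ²)` on `ℝⁿ`. -/
def quadForm (n : ℕ) : QuadraticForm ℝ (Fin n → ℝ) :=
  QuadraticMap.weightedSumSquares ℝ (fun _ : Fin n => (-1 : ℝ))

/-- The real Clifford algebra `ℝₙ`: the units satisfy `eᵢ² = -1` and `eᵢ eⱼ = - eⱼ eᵢ`. -/
abbrev Cl (n : ℕ) : Type := CliffordAlgebra (quadForm n)

variable {n : ℕ}

/-- The imaginary units; `e i` is the unit that is usually written `e_{i+1}`. -/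
def e (i : Fin n) : Cl n := CliffordAlgebra.ι (quadForm n) (Pi.single i 1)

/-- The ordered product `e_A = e_{i₁} ⋯ e_{iᵣ}` for `A = {i₁ < ⋯ < iᵣ}`; `e_∅ = 1`. -/
def eProd (A : Finset (Fin n)) : Cl n := ((A.sort (· ≤ ·)).map e).prod

lemma quadForm_apply (v : Fin n → ℝ) : quadForm n v = -∑ i, v i * v i := by
  simp [quadForm, QuadraticMap.weightedSumSquares_apply]

lemma e_mul_self (i : Fin n) : e i * e i = -1 := by
  rw [e, CliffordAlgebra.ι_sq_scalar, quadForm_apply]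
  simp [Pi.single_apply]

lemma e_mul_e {i j : Fin n} (h : i ≠ j) : e i * e j = -(e j * e i) := by
  have := CliffordAlgebra.ι_mul_ι_add_swap (Q := quadForm n) (Pi.single i 1) (Pi.single j 1)
  rw [eq_neg_iff_add_eq_zero, e, e, this]
  have : QuadraticMap.polar (quadForm n) (Pi.single i 1) (Pi.single j 1) = 0 := by
    simp only [QuadraticMap.polar, quadForm_apply, Pi.add_apply]
    set u : Fin n → Fin n → ℝ := fun i => Pi.single i 1 with hu
    have : ∀ k, (u i k + u j k) * (u i k + u j k) = u i k * u i k + u j k * u j k := by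
      intro k
      by_cases hk : k = i
      · subst hk; simp [hu, h]
      · simp [hu, Pi.single_apply, hk]
    change -∑ k, (u i k + u j k) * (u i k + u j k) - -∑ k, u i k * u i k - -∑ k, u j k * u j k = 0
    simp only [this, Finset.sum_add_distrib]
    ring
  simp [this]

/-! The ordered products form a basis: the coordinates are found by letting the algebra act on
`ℝ^(2^n)` through `eᵢ e_A = ± e_{A ∆ {i}}`. -/

/-- `A ∆ {i}`. -/
def toggle (i : Fin n) (A : Finset (Fin n)) : Finset (Fin n) := if i ∈ A then A.erase i else insert i A

/-- The sign in `eᵢ e_A = ± e_{A ∆ {i}}`. -/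
def sgn (i : Fin n) (A : Finset (Fin n)) : ℝ := ∏ j ∈ A, if j ≤ i then -1 else 1

lemma mem_toggle (i j : Fin n) (A : Finset (Fin n)) :
    j ∈ toggle i A ↔ (if j = i then i ∉ A else j ∈ A) := by
  unfold toggle; split_ifs <;> simp_all

lemma toggle_toggle (i : Fin n) (A : Finset (Fin n)) : toggle i (toggle i A) = A := by
  ext k; rw [mem_toggle, mem_toggle, mem_toggle]; split_ifs with h1 <;> simp_all

lemma toggle_comm (i j : Fin n) (A : Finset (Fin n)) :
    toggle i (toggle j A) = toggle j (toggle i A) := by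
  rcases eq_or_ne i j with rfl | h
  · rfl
  · ext k
    simp only [mem_toggle, if_neg h, if_neg h.symm]
    by_cases h1 : k = i
    · subst h1; simp [h]
    · by_cases h2 : k = j
      · subst h2; simp [h.symm]
      · simp [h1, h2]

lemma sgn_toggle (i j : Fin n) (A : Finset (Fin n)) :
    sgn i (toggle j A) = (if j ≤ i then -1 else 1) * sgn i A := by
  unfold toggle
  split_ifs with h1 h2 h2
  · rw [sgn, sgn, ← Finset.mul_prod_erase A _ h1]; simp [h2]
  · rw [sgn, sgn, ← Finset.mul_prod_erase A _ h1]; simp [h2]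
  · rw [sgn, sgn, Finset.prod_insert h1]; simp [h2]
  · rw [sgn, sgn, Finset.prod_insert h1]; simp [h2]

lemma sgn_mul_self (i : Fin n) (A : Finset (Fin n)) : sgn i A * sgn i A = 1 := by
  rw [sgn, ← Finset.prod_mul_distrib]
  apply Finset.prod_eq_one
  intro j _; split_ifs <;> simp

/-- Left multiplication by the vector `w`, in coordinates. -/
def leftMul : (Fin n → ℝ) →ₗ[ℝ] Module.End ℝ (Finset (Fin n) → ℝ) :=
  LinearMap.mk₂ ℝ (fun w v C => ∑ i, w i * (sgn i (toggle i C) * v (toggle i C)))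
    (by intros; ext; simp [add_mul, Finset.sum_add_distrib])
    (by intros; ext; simp [mul_assoc, Finset.mul_sum])
    (by intros; ext; simp [mul_add, Finset.sum_add_distrib])
    (by intros; ext; simp only [Pi.smul_apply, smul_eq_mul, Finset.mul_sum]
        exact Finset.sum_congr rfl fun _ _ => by ring)

lemma leftMul_apply (w : Fin n → ℝ) (v : Finset (Fin n) → ℝ) (C : Finset (Fin n)) :
    leftMul w v C = ∑ i, w i * (sgn i (toggle i C) * v (toggle i C)) := rfl

lemma leftMul_sq (w : Fin n → ℝ) :
    leftMul w * leftMul w = algebraMap ℝ (Module.End ℝ (Finset (Fin n) → ℝ)) (quadForm n w) := by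
  refine LinearMap.ext fun v => ?_
  funext C
  have key : ∀ i j : Fin n,
      (sgn i (toggle i C) * sgn j (toggle j (toggle i C)) * v (toggle j (toggle i C)))
      + (sgn j (toggle j C) * sgn i (toggle i (toggle j C)) * v (toggle i (toggle j C)))
      = if i = j then -2 * v C else 0 := by
    intro i j
    rw [toggle_comm j i]
    split_ifs with h
    · subst h
      have := sgn_mul_self i C
      rw [toggle_toggle, sgn_toggle]
      simp only [le_refl, if_true]
      linear_combination (-2 * v C) * this
    · simp only [sgn_toggle, le_refl, if_true]
      rcases lt_or_gt_of_ne h with h | h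
      · simp only [h.le, not_le.mpr h, if_true, if_false]; ring
      · simp only [h.le, not_le.mpr h, if_true, if_false]; ring
  have e1 : (leftMul w * leftMul w) v C = ∑ i, ∑ j, w i * w j *
      (sgn i (toggle i C) * sgn j (toggle j (toggle i C)) * v (toggle j (toggle i C))) := by
    change leftMul w (leftMul w v) C = _
    rw [leftMul_apply]
    refine Finset.sum_congr rfl fun i _ => ?_
    rw [leftMul_apply, Finset.mul_sum, Finset.mul_sum]
    exact Finset.sum_congr rfl fun j _ => by ring
  have e2 : (leftMul w * leftMul w) v C = ∑ i, ∑ j, w i * w j *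
      (sgn j (toggle j C) * sgn i (toggle i (toggle j C)) * v (toggle i (toggle j C))) := by
    rw [e1, Finset.sum_comm]
    exact Finset.sum_congr rfl fun i _ => Finset.sum_congr rfl fun j _ => by ring
  have e3 : (leftMul w * leftMul w) v C + (leftMul w * leftMul w) v C = -2 * ((∑ i, w i * w i) * v C) := by
    conv_lhs => rw [e1]
    conv_lhs => arg 2; rw [← e1, e2]
    rw [← Finset.sum_add_distrib]
    simp only [← Finset.sum_add_distrib, ← mul_add, key, mul_ite, mul_zero, Finset.sum_ite_eq,
      Finset.mem_univ, if_true]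
    rw [Finset.sum_mul, Finset.mul_sum]
    exact Finset.sum_congr rfl fun i _ => by ring
  have e4 : algebraMap ℝ (Module.End ℝ (Finset (Fin n) → ℝ)) (quadForm n w) v C
      = quadForm n w * v C := by
    simp [Module.algebraMap_end_apply]
  rw [e4, quadForm_apply]
  linarith

/-- The algebra acting on coordinate vectors by left multiplication. -/
def leftRep : Cl n →ₐ[ℝ] Module.End ℝ (Finset (Fin n) → ℝ) :=
  CliffordAlgebra.lift (quadForm n) ⟨leftMul, leftMul_sq⟩

/-- The coordinates `(y_A)_A` of a Clifford number. -/
def coord : Cl n →ₗ[ℝ] (Finset (Fin n) → ℝ) :=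
  (LinearMap.applyₗ (Pi.single ∅ 1)).comp leftRep.toLinearMap

lemma coord_one : coord (1 : Cl n) = Pi.single ∅ 1 := by simp [coord]

lemma coord_ι_mul (w : Fin n → ℝ) (y : Cl n) :
    coord (CliffordAlgebra.ι (quadForm n) w * y) = leftMul w (coord y) := by
  simp [coord, leftRep]

lemma leftMul_single (i : Fin n) (A : Finset (Fin n)) :
    leftMul (Pi.single i 1) (Pi.single A 1) = sgn i A • Pi.single (toggle i A) (1 : ℝ) := by
  funext C
  rw [leftMul_apply, Finset.sum_eq_single i]
  · by_cases h : C = toggle i A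
    · subst h; simp [toggle_toggle]
    · have h' : toggle i C ≠ A := fun h' => h (by rw [← h', toggle_toggle])
      simp [h, h']
  · intro j _ hj; simp [Pi.single_apply, hj]
  · simp

lemma eProd_empty : eProd (∅ : Finset (Fin n)) = 1 := by simp [eProd]

lemma eProd_insert {a : Fin n} {s : Finset (Fin n)} (h : ∀ b ∈ s, a < b) :
    eProd (insert a s) = e a * eProd s := by
  have ha : a ∉ s := fun hs => lt_irrefl _ (h a hs)
  rw [eProd, Finset.sort_insert _ (fun b hb => (h b hb).le) ha, List.map_cons, List.prod_cons, eProd]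

lemma sgn_of_lt {a : Fin n} {s : Finset (Fin n)} (h : ∀ b ∈ s, a < b) : sgn a s = 1 :=
  Finset.prod_eq_one fun b hb => by simp [h b hb]

lemma toggle_of_lt {a : Fin n} {s : Finset (Fin n)} (h : ∀ b ∈ s, a < b) :
    toggle a s = insert a s := if_neg fun hs => lt_irrefl _ (h a hs)

lemma coord_eProd (A : Finset (Fin n)) : coord (eProd A) = Pi.single A 1 := by
  induction A using Finset.induction_on_min with
  | empty => rw [eProd_empty, coord_one]
  | insert a s h ih =>
    rw [eProd_insert h, e, coord_ι_mul, ih, leftMul_single, sgn_of_lt h, toggle_of_lt h, one_smul]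

lemma e_mul_eProd (i : Fin n) (A : Finset (Fin n)) :
    e i * eProd A = sgn i A • eProd (toggle i A) := by
  induction A using Finset.induction_on_min with
  | empty =>
    have h : ∀ b ∈ (∅ : Finset (Fin n)), i < b := by simp
    rw [sgn_of_lt h, toggle_of_lt h, eProd_insert h, one_smul]
  | insert a s h ih =>
    have ha : a ∉ s := fun hs => lt_irrefl _ (h a hs)
    rcases lt_trichotomy i a with hia | rfl | hia
    · have h' : ∀ b ∈ insert a s, i < b := by
        intro b hb
        rcases Finset.mem_insert.mp hb with rfl | hb
        · exact hia
        · exact hia.trans (h b hb)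
      rw [sgn_of_lt h', toggle_of_lt h', eProd_insert h', one_smul]
    · have h1 : toggle i (insert i s) = s := by
        rw [← toggle_of_lt h, toggle_toggle]
      have h2 : sgn i (insert i s) = -1 := by
        rw [← toggle_of_lt h, sgn_toggle, sgn_of_lt h]; simp
      rw [h1, h2, eProd_insert h, ← mul_assoc, e_mul_self]; simp
    · have hm : ∀ b ∈ toggle i s, a < b := by
        intro b hb
        rw [mem_toggle] at hb
        split_ifs at hb with hbi
        · rw [hbi]; exact hia
        · exact h b hb
      have h1 : toggle i (insert a s) = insert a (toggle i s) := by
        rw [← toggle_of_lt h, toggle_comm, toggle_of_lt hm]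
      have h2 : sgn i (insert a s) = -sgn i s := by
        rw [← toggle_of_lt h, sgn_toggle]; simp [hia.le]
      rw [h1, h2, eProd_insert h, eProd_insert hm, ← mul_assoc, e_mul_e hia.ne', neg_mul,
        mul_assoc, ih, mul_smul_comm, neg_smul]

lemma ι_eq_sum (w : Fin n → ℝ) : CliffordAlgebra.ι (quadForm n) w = ∑ i, w i • e i := by
  conv_lhs => rw [← Finset.univ_sum_single w]
  rw [map_sum]
  refine Finset.sum_congr rfl fun i _ => ?_
  rw [e, ← map_smul, ← Pi.single_smul, smul_eq_mul, mul_one]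

lemma sum_leftMul (w : Fin n → ℝ) (v : Finset (Fin n) → ℝ) :
    ∑ A, leftMul w v A • eProd A = CliffordAlgebra.ι (quadForm n) w * ∑ A, v A • eProd A := by
  rw [ι_eq_sum, Finset.sum_mul]
  simp only [leftMul_apply, Finset.sum_smul]
  rw [Finset.sum_comm]
  refine Finset.sum_congr rfl fun i _ => ?_
  rw [Finset.mul_sum]
  refine Finset.sum_bij' (fun A _ => toggle i A) (fun A _ => toggle i A) (by simp) (by simp)
    (fun A _ => toggle_toggle i A) (fun A _ => toggle_toggle i A) fun A _ => ?_
  rw [smul_mul_smul_comm, e_mul_eProd, toggle_toggle, smul_smul]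
  congr 1; ring

lemma sum_coord (y : Cl n) : ∑ A, coord y A • eProd A = y := by
  induction y using CliffordAlgebra.left_induction with
  | algebraMap r =>
    rw [Algebra.algebraMap_eq_smul_one, map_smul, coord_one, Finset.sum_eq_single ∅]
    · simp [eProd_empty]
    · intro A _ hA; simp [hA]
    · simp
  | add x y hx hy => simp [add_smul, Finset.sum_add_distrib, hx, hy]
  | ι_mul x m hx => rw [coord_ι_mul, sum_leftMul, hx]

/-- The basis `(e_A)_A` of `ℝₙ`; `A` runs over all subsets of the index set. -/
def basis (n : ℕ) : Module.Basis (Finset (Fin n)) ℝ (Cl n) :=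
  Module.Basis.ofEquivFun
    { coord with
      invFun := fun v => ∑ A, v A • eProd A
      left_inv := sum_coord
      right_inv := fun v => by
        change coord (∑ A, v A • eProd A) = v
        rw [map_sum]
        simp only [map_smul, coord_eProd]
        funext C
        simp [Finset.sum_apply, Pi.single_apply] }

lemma basis_apply (A : Finset (Fin n)) : basis n A = eProd A := by
  simp [basis, Module.Basis.ofEquivFun, Pi.single_apply]

/-- The coordinate vector of a Clifford number in Euclidean space. -/
def toEuclidean (n : ℕ) : Cl n →ₗ[ℝ] EuclideanSpace ℝ (Finset (Fin n)) :=
  (WithLp.linearEquiv 2 ℝ (Finset (Fin n) → ℝ)).symm.toLinearMap.comp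
    (basis n).equivFun.toLinearMap

lemma toEuclidean_injective (n : ℕ) : Function.Injective (toEuclidean n) :=
  (WithLp.linearEquiv 2 ℝ (Finset (Fin n) → ℝ)).symm.injective.comp (basis n).equivFun.injective

/-- The Euclidean norm `|y|² = ∑_A y_A²` on `ℝₙ`; see `norm_eq`. -/
instance instNormedAddCommGroup : NormedAddCommGroup (Cl n) :=
  NormedAddCommGroup.induced (Cl n) (EuclideanSpace ℝ (Finset (Fin n))) (toEuclidean n)
    (toEuclidean_injective n)

instance instNormedSpace : NormedSpace ℝ (Cl n) :=
  NormedSpace.induced ℝ (Cl n) (EuclideanSpace ℝ (Finset (Fin n))) (toEuclidean n)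

lemma norm_eq (y : Cl n) : ‖y‖ = √(∑ A, (basis n).repr y A ^ 2) := by
  change ‖toEuclidean n y‖ = _
  rw [EuclideanSpace.norm_eq]
  simp [toEuclidean]

/-! ### Paravectors, monogenic functions, entire functions of order one -/

/-- The paravector `x = x₀ + x₁ e₁ + … + xₙ eₙ` is identified with `(x₀, …, xₙ) ∈ ℝ^{n+1}`;
the norm is the Euclidean one. -/
abbrev Para (n : ℕ) : Type := EuclideanSpace ℝ (Fin (n + 1))

/-- The partial derivative `∂f/∂x_k` at `x`. -/
def partialDeriv (k : Fin (n + 1)) (f : Para n → Cl n) (x : Para n) : Cl n :=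
  fderiv ℝ f x (EuclideanSpace.single k 1)

/-- Entire left monogenic functions: `C¹` on `ℝ^{n+1}` with `∂₀ f + ∑ eᵢ ∂ᵢ f = 0`. -/
def IsEntireMonogenic (f : Para n → Cl n) : Prop :=
  ContDiff ℝ 1 f ∧
    ∀ x, partialDeriv 0 f x + ∑ i : Fin n, e i * partialDeriv i.succ f x = 0

/-- The Banach space `A_{1,σ}`: entire left monogenic functions with
`sup_x |f(x)| e^{-σ|x|} < ∞`. -/
def MemA (σ : ℝ) (f : Para n → Cl n) : Prop :=
  IsEntireMonogenic f ∧ BddAbove (Set.range fun x => ‖f x‖ * Real.exp (-σ * ‖x‖))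

/-- The norm `‖f‖_{1,σ} = sup_x |f(x)| e^{-σ|x|}` of `A_{1,σ}`. -/
def normA (σ : ℝ) (f : Para n → Cl n) : ℝ :=
  ⨆ x, ‖f x‖ * Real.exp (-σ * ‖x‖)

/-- Convergence `f_N → f` in `A₁`, the inductive limit of the spaces `A_{1,σ}`, `σ > 0`. -/
def ConvergesInA (f : ℕ → Para n → Cl n) (g : Para n → Cl n) : Prop :=
  ∃ σ : ℝ, 0 < σ ∧ MemA σ g ∧ (∀ N, MemA σ (f N)) ∧
    Tendsto (fun N => normA σ (f N - g)) atTop (𝓝 0)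

/-! ### The monogenic exponential -/

/-- The Fueter variables `z_i = x_i - x_0 e_i`, `i = 1, …, n`. -/
def fueterVar (i : Fin n) (x : Para n) : Cl n :=
  algebraMap ℝ (Cl n) (x i.succ) - x 0 • e i

/-- The Fueter polynomial `(1/k!) ∑_σ z_{ℓ(σ 1)} ⋯ z_{ℓ(σ k)}`, the sum over all permutations
of `k` letters. It depends only on the multi-index that counts how often each `i` occurs in
the sequence `ℓ`; it is the CK product of `z_{ℓ 1}, …, z_{ℓ k}`. -/
def fueterPoly {k : ℕ} (ℓ : Fin k → Fin n) (x : Para n) : Cl n :=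
  ((k.factorial : ℝ)⁻¹) •
    ∑ σ : Equiv.Perm (Fin k), (List.ofFn fun i => fueterVar (ℓ (σ i)) x).prod

/-- The `k`-th CK power `(z₁ e₁ + … + zₙ eₙ)^{⊙ k}`, that is, the sum over all
`ℓ₁, …, ℓ_k` of the Fueter polynomial of `ℓ` times `e_{ℓ₁} ⋯ e_{ℓ_k}`. -/
def ckPow (k : ℕ) (x : Para n) : Cl n :=
  ∑ ℓ : Fin k → Fin n, fueterPoly ℓ x * (List.ofFn fun i => e (ℓ i)).prod

/-- The monogenic exponential `E(x) = ∑_k (1/k!) (z₁ e₁ + … + zₙ eₙ)^{⊙ k}`, the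
Cauchy–Kowalewski extension of `exp (x₁ e₁ + … + xₙ eₙ)`. -/
def monoExp (x : Para n) : Cl n := ∑' k : ℕ, ((k.factorial : ℝ)⁻¹) • ckPow k x

/-! ### Superoscillating sequences in several Clifford variables -/

/-- The paravector `e₀ x₀ c₀ + e₁ x₁ c₁ + … + eₙ xₙ cₙ`, `e₀ = 1`. -/
def scale (c : Fin (n + 1) → ℝ) (x : Para n) : Para n := WithLp.toLp 2 fun k => x k * c k

/-- `F_N(x) = ∑_{j=0}^N Z_j(N) E(e₀ x₀ h_{j,0}(N) + … + eₙ xₙ h_{j,n}(N))`;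
`Z N j` and `h N j ℓ` stand for `Z_j(N)` and `h_{j,ℓ}(N)`. -/
def expSum (Z : ℕ → ℕ → Cl n) (h : ℕ → ℕ → Fin (n + 1) → ℝ) (N : ℕ) (x : Para n) : Cl n :=
  ∑ j ∈ Finset.range (N + 1), Z N j * monoExp (scale (h N j) x)

/-- The sequence `expSum Z h` is superoscillating at `a`, with limit frequencies
`g₀(a), …, gₙ(a)`. -/
def IsSuperoscillating (a : ℝ) (Z : ℕ → ℕ → Cl n) (h : ℕ → ℕ → Fin (n + 1) → ℝ)
    (g : Fin (n + 1) → ℝ → ℝ) : Prop :=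
  (∀ N, ∀ j ≤ N, ∀ ℓ, |h N j ℓ| ≤ 1) ∧
  (∀ ℓ, Continuous (g ℓ)) ∧
  (∀ ℓ : Fin n, 1 < |g ℓ.succ a|) ∧
  ∀ K : Set (Para n), IsCompact K →
    TendstoUniformlyOn (expSum Z h) (fun x => monoExp (scale (fun ℓ => g ℓ a) x)) atTop K

end Cliff

end

/-!
The difference `f_N(x) - E(a x)` is a finite combination of exponentials, and on the axis of a unit
`e_i` one has `E(t e_i) = cos t + sin t e_i` (`monoExp_single`). Its `k`-th derivative along that
axis at the origin is therefore `e_i^k (∑_j h_j(N)^k Z_j(N) - a^k)`.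

Smallness of a function on that axis alone gives no control of its derivatives; this is where
monogenicity enters. A monogenic function has the mean value property
(`IsEntireMonogenic.integral_bump_smul_eq`): multiplying the equation `∑ e_j ∂_j v = 0` by the
conjugate of `x` writes the radial derivative of `v` as a combination of the rotations
`x_i ∂_j - x_j ∂_i` of `v`, which integrate to zero against radial weights. Convolving with a smooth
radial bump function gives a gradient estimate on unit balls, and since `e^{σ|x|}` changes by at
most the factor `e^σ` on such a ball, directional derivatives are bounded operators on `A_{1,σ}`
(`exists_norm_fderiv_le`). Iterating them bounds the moment errors by
`‖∑_j h_j(N)^k Z_j(N) - a^k‖ ≤ K^k ‖f_N - E(a ·)‖_{1,σ}`, with `K` independent of `N` and `k`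
(`exists_norm_moment_sub_le`).

On the other side, `t ↦ E(e_0 x_0 g_0(t) + … + e_n x_n g_n(t))` is a power series `∑ c_l(x) t^l`
such that `∑ ‖c_l(x)‖ ρ^l` is finite for each `ρ`, uniformly for bounded `x`
(`psBound_monoExp`): weighted `ℓ¹` norms of power series are submultiplicative, and `E` is a series
of polynomials with factorially decaying coefficients. The difference of `F_N(x)` and its limit is
`∑_l (∑_j h_j(N)^l Z_j(N) - a^l) c_l(x)`, so with `ρ ≥ K` it is at most a constant times
`‖f_N - E(a ·)‖_{1,σ}` (`exists_norm_transform_le`). For `n = 0` there is no axis, but then `E = 1`.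
-/

noncomputable section

namespace Cliff

/-! ### Power series bounded on a disc -/

/-- `q` is represented on `[-ρ, ρ]` by a power series `∑ t^l c_l` whose weighted `ℓ¹` norm
`∑ ‖c_l‖ ρ^l` is finite and at most `S`. -/
def PSBound {V : Type*} [NormedAddCommGroup V] [NormedSpace ℝ V] (ρ : ℝ) (q : ℝ → V) (S : ℝ) :
    Prop :=
  ∃ c : ℕ → V, (Summable fun l => ‖c l‖ * ρ ^ l) ∧ ∑' l, ‖c l‖ * ρ ^ l ≤ S ∧
    ∀ t, |t| ≤ ρ → HasSum (fun l => t ^ l • c l) (q t)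

namespace PSBound

variable {V W : Type*} [NormedAddCommGroup V] [NormedSpace ℝ V]
  [NormedAddCommGroup W] [NormedSpace ℝ W] {ρ S S' : ℝ} {q q' : ℝ → V}

lemma mono (h : PSBound ρ q S) (hS : S ≤ S') : PSBound ρ q S' := by
  obtain ⟨c, h1, h2, h3⟩ := h
  exact ⟨c, h1, h2.trans hS, h3⟩

lemma congr (h : PSBound ρ q S) (hq : ∀ t, q' t = q t) (hS : S' = S) : PSBound ρ q' S' := by
  rw [funext hq, hS]; exact h

lemma norm_term_le {t : ℝ} (ht : |t| ≤ ρ) (v : V) (l : ℕ) : ‖t ^ l • v‖ ≤ ‖v‖ * ρ ^ l := by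
  rw [norm_smul, norm_pow, Real.norm_eq_abs, mul_comm]
  gcongr

lemma norm_le (h : PSBound ρ q S) {t : ℝ} (ht : |t| ≤ ρ) : ‖q t‖ ≤ S := by
  obtain ⟨c, h1, h2, h3⟩ := h
  rw [← (h3 t ht).tsum_eq]
  exact (tsum_of_norm_bounded h1.hasSum fun l => norm_term_le ht (c l) l).trans h2

lemma const (v : V) : PSBound ρ (fun _ => v) ‖v‖ := by
  refine ⟨fun l => if l = 0 then v else 0, ?_, ?_, ?_⟩
  · exact summable_of_ne_finset_zero (s := {0}) fun l hl => by
      have hl : l ≠ 0 := by simpa using hl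
      simp [hl]
  · rw [tsum_eq_single 0 fun l hl => by simp [hl]]; simp
  · intro t _
    convert hasSum_single (f := fun l => t ^ l • (if l = 0 then v else 0 : V)) 0 ?_ using 1
    · simp
    · intro l hl; simp [hl]

lemma add (h : PSBound ρ q S) (h' : PSBound ρ q' S') (hρ : 0 ≤ ρ) :
    PSBound ρ (fun t => q t + q' t) (S + S') := by
  obtain ⟨c, h1, h2, h3⟩ := h
  obtain ⟨c', h1', h2', h3'⟩ := h'
  have hle : ∀ l, ‖c l + c' l‖ * ρ ^ l ≤ ‖c l‖ * ρ ^ l + ‖c' l‖ * ρ ^ l := fun l => by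
    rw [← add_mul]; gcongr; exact norm_add_le _ _
  have hs : Summable fun l => ‖c l + c' l‖ * ρ ^ l :=
    Summable.of_nonneg_of_le (fun l => by positivity) hle (h1.add h1')
  refine ⟨fun l => c l + c' l, hs, ?_, fun t ht => ?_⟩
  · refine (hs.tsum_le_tsum hle (h1.add h1')).trans ?_
    rw [h1.tsum_add h1']; gcongr
  · simpa only [smul_add] using (h3 t ht).add (h3' t ht)

/-- A bounded linear map sends power series to power series. -/
lemma map (h : PSBound ρ q S) (hρ : 0 ≤ ρ) (T : V →L[ℝ] W) {M : ℝ} (hM : ‖T‖ ≤ M) :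
    PSBound ρ (fun t => T (q t)) (M * S) := by
  obtain ⟨c, h1, h2, h3⟩ := h
  have hM0 : 0 ≤ M := (norm_nonneg T).trans hM
  have hle : ∀ l, ‖T (c l)‖ * ρ ^ l ≤ M * (‖c l‖ * ρ ^ l) := fun l => by
    rw [← mul_assoc]; gcongr; exact T.le_of_opNorm_le hM _
  have hs : Summable fun l => ‖T (c l)‖ * ρ ^ l :=
    Summable.of_nonneg_of_le (fun l => by positivity) hle (h1.mul_left M)
  refine ⟨fun l => T (c l), hs, ?_, fun t ht => ?_⟩
  · refine (hs.tsum_le_tsum hle (h1.mul_left M)).trans ?_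
    rw [tsum_mul_left]; gcongr
  · simpa using (h3 t ht).mapL T

lemma smul (h : PSBound ρ q S) (hρ : 0 ≤ ρ) (r : ℝ) : PSBound ρ (fun t => r • q t) (|r| * S) :=
  h.map hρ (r • ContinuousLinearMap.id ℝ V) <| by
    rw [norm_smul, Real.norm_eq_abs]
    exact mul_le_of_le_one_right (abs_nonneg r) ContinuousLinearMap.norm_id_le

lemma sum {ι : Type*} {s : Finset ι} {Q : ι → ℝ → V} {B : ι → ℝ} (hρ : 0 ≤ ρ)
    (h : ∀ i ∈ s, PSBound ρ (Q i) (B i)) :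
    PSBound ρ (fun t => ∑ i ∈ s, Q i t) (∑ i ∈ s, B i) := by
  classical
  induction s using Finset.induction_on with
  | empty => simpa using const (ρ := ρ) (0 : V)
  | insert a s ha ih =>
    simp only [Finset.sum_insert ha]
    exact (h a (by simp)).add (ih fun i hi => h i (by simp [hi])) hρ

/-- A series of power series whose weighted norms are summable is again one. -/
lemma tsum [CompleteSpace V] {Q : ℕ → ℝ → V} {B : ℕ → ℝ} (hρ : 0 < ρ) (hB : Summable B)
    (h : ∀ k, PSBound ρ (Q k) (B k)) :
    PSBound ρ (fun t => ∑' k, Q k t) (∑' k, B k) := by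
  choose c h1 h2 h3 using h
  have hpair : Summable fun p : ℕ × ℕ => ‖c p.1 p.2‖ * ρ ^ p.2 := by
    refine (summable_prod_of_nonneg fun p => by positivity).2 ⟨h1, ?_⟩
    exact Summable.of_nonneg_of_le (fun k => tsum_nonneg fun l => by positivity) h2 hB
  have hswap := hpair.prod_symm
  have hcol : ∀ l, Summable fun k => ‖c k l‖ := fun l => by
    have := (hswap.prod_factor l).mul_right ((ρ ^ l)⁻¹)
    refine this.congr fun k => ?_
    simp only [Prod.swap_prod_mk]
    field_simp
  have hle : ∀ l, ‖∑' k, c k l‖ * ρ ^ l ≤ ∑' k, ‖c k l‖ * ρ ^ l := fun l => by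
    rw [tsum_mul_right]; gcongr; exact norm_tsum_le_tsum_norm (hcol l)
  have hsum : Summable fun l => ∑' k, ‖c k l‖ * ρ ^ l := hswap.prod
  have hs : Summable fun l => ‖∑' k, c k l‖ * ρ ^ l :=
    Summable.of_nonneg_of_le (fun l => by positivity) hle hsum
  refine ⟨fun l => ∑' k, c k l, hs, ?_, fun t ht => ?_⟩
  · refine (hs.tsum_le_tsum hle hsum).trans ?_
    rw [Summable.tsum_comm (f := fun k l => ‖c k l‖ * ρ ^ l) hpair]
    exact Summable.tsum_le_tsum h2 hpair.prod hB
  · have hp : Summable fun p : ℕ × ℕ => t ^ p.2 • c p.1 p.2 :=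
      Summable.of_norm_bounded hpair fun p => norm_term_le ht _ _
    have e1 : ∑' p : ℕ × ℕ, t ^ p.2 • c p.1 p.2 = ∑' k, Q k t :=
      (hp.hasSum.prod_fiberwise fun k => h3 k t ht).tsum_eq.symm
    change HasSum _ (∑' k, Q k t)
    rw [← e1]
    have hp' : HasSum (fun p : ℕ × ℕ => t ^ p.1 • c p.2 p.1)
        (∑' p : ℕ × ℕ, t ^ p.2 • c p.1 p.2) :=
      (Equiv.prodComm ℕ ℕ).hasSum_iff.2 hp.hasSum
    refine hp'.prod_fiberwise fun l => ?_
    exact ((hcol l).of_norm.hasSum).const_smul (t ^ l)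

section Ring

variable {R : Type*} [NormedRing R] [NormedAlgebra ℝ R] [CompleteSpace R] {p p' : ℝ → R}

/-- Cauchy products: the weighted `ℓ¹` norm is submultiplicative. -/
lemma mul (h : PSBound ρ p S) (h' : PSBound ρ p' S') (hρ : 0 ≤ ρ) :
    PSBound ρ (fun t => p t * p' t) (S * S') := by
  obtain ⟨c, h1, h2, h3⟩ := h
  obtain ⟨c', h1', h2', h3'⟩ := h'
  have hn : Summable fun l => ‖‖c l‖ * ρ ^ l‖ := by simpa using h1.norm
  have hn' : Summable fun l => ‖‖c' l‖ * ρ ^ l‖ := by simpa using h1'.norm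
  have hle : ∀ l, ‖∑ kl ∈ Finset.HasAntidiagonal.antidiagonal l, c kl.1 * c' kl.2‖ * ρ ^ l ≤
      ∑ kl ∈ Finset.HasAntidiagonal.antidiagonal l, ‖c kl.1‖ * ρ ^ kl.1 * (‖c' kl.2‖ * ρ ^ kl.2) :=
    fun l => by
    calc _ ≤ (∑ kl ∈ Finset.HasAntidiagonal.antidiagonal l, ‖c kl.1‖ * ‖c' kl.2‖) * ρ ^ l := by
          gcongr
          exact norm_sum_le_of_le _ fun kl _ => norm_mul_le _ _
      _ = _ := by
          rw [Finset.sum_mul]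
          refine Finset.sum_congr rfl fun kl hkl => ?_
          rw [← Finset.HasAntidiagonal.mem_antidiagonal.1 hkl, pow_add]; ring
  have hsum := (summable_norm_sum_mul_antidiagonal_of_summable_norm hn hn').of_norm
  have hs := Summable.of_nonneg_of_le (fun l => by positivity) hle hsum
  refine ⟨_, hs, ?_, fun t ht => ?_⟩
  · refine (hs.tsum_le_tsum hle hsum).trans ?_
    rw [← tsum_mul_tsum_eq_tsum_sum_antidiagonal_of_summable_norm hn hn']
    have : 0 ≤ ∑' l, ‖c l‖ * ρ ^ l := tsum_nonneg fun l => by positivity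
    have : 0 ≤ ∑' l, ‖c' l‖ * ρ ^ l := tsum_nonneg fun l => by positivity
    gcongr
    linarith
  · have a1 : Summable fun l => ‖t ^ l • c l‖ :=
      Summable.of_nonneg_of_le (fun l => norm_nonneg _) (fun l => norm_term_le ht _ _) h1
    have a2 : Summable fun l => ‖t ^ l • c' l‖ :=
      Summable.of_nonneg_of_le (fun l => norm_nonneg _) (fun l => norm_term_le ht _ _) h1'
    have a3 := (summable_norm_sum_mul_antidiagonal_of_summable_norm a1 a2).of_norm.hasSum
    rw [← tsum_mul_tsum_eq_tsum_sum_antidiagonal_of_summable_norm a1 a2, (h3 t ht).tsum_eq,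
      (h3' t ht).tsum_eq] at a3
    refine a3.congr_fun fun l => ?_
    rw [Finset.smul_sum]
    refine Finset.sum_congr rfl fun kl hkl => ?_
    rw [← Finset.HasAntidiagonal.mem_antidiagonal.1 hkl, pow_add, smul_mul_smul_comm]

lemma list_prod (hρ : 0 ≤ ρ) (h1 : ‖(1 : R)‖ ≤ 1) {k : ℕ} {Q : Fin k → ℝ → R}
    (h : ∀ i, PSBound ρ (Q i) S) :
    PSBound ρ (fun t => (List.ofFn fun i => Q i t).prod) (S ^ k) := by
  induction k with
  | zero => simpa using (const (ρ := ρ) (1 : R)).mono h1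
  | succ k ih =>
    simp only [List.ofFn_succ, List.prod_cons, pow_succ']
    exact (h 0).mul (ih fun i => h i.succ) hρ

end Ring

end PSBound

variable {n : ℕ}

/-! ### The Clifford product as a bounded bilinear map -/

instance instFiniteDimensional : FiniteDimensional ℝ (Cl n) := Module.Finite.of_basis (basis n)

instance instCompleteSpace : CompleteSpace (Cl n) := FiniteDimensional.complete ℝ (Cl n)

/-- Left multiplication as a bounded operator. The Euclidean norm is not submultiplicative, but
`mulL` embeds `ℝₙ` in the Banach algebra of bounded operators on `ℝₙ`. -/
def mulL (n : ℕ) : Cl n →L[ℝ] Cl n →L[ℝ] Cl n := (LinearMap.mul ℝ (Cl n)).toContinuousBilinearMap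

lemma mulL_apply (x y : Cl n) : mulL n x y = x * y := rfl

lemma mulL_mul (x y : Cl n) : mulL n (x * y) = mulL n x * mulL n y := by
  ext z; simp [mulL_apply, mul_assoc]

lemma mulL_one : mulL n 1 = 1 := by
  ext z; simp [mulL_apply]

lemma mulL_algebraMap (r : ℝ) : mulL n (algebraMap ℝ (Cl n) r) = r • 1 := by
  rw [Algebra.algebraMap_eq_smul_one, map_smul, mulL_one]

lemma norm_mul_le_mulL (x y : Cl n) : ‖x * y‖ ≤ ‖mulL n‖ * ‖x‖ * ‖y‖ :=
  (mulL n).le_opNorm₂ x y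

lemma norm_one_cl : ‖(1 : Cl n)‖ = 1 := by
  rw [← eProd_empty, ← basis_apply, norm_eq, Module.Basis.repr_self,
    Finset.sum_eq_single ∅ (fun A _ hA => by simp [hA.symm]) (by simp)]
  simp

lemma mulL_list_prod (l : List (Cl n)) : mulL n l.prod = (l.map (mulL n)).prod := by
  induction l with
  | nil => simp [mulL_one]
  | cons a l ih => simp [mulL_mul, ih]

/-- A common bound for the operators of left multiplication by the units. -/
lemma exists_norm_mulL_e_le (n : ℕ) : ∃ B : ℝ, 0 ≤ B ∧ ∀ i : Fin n, ‖mulL n (e i)‖ ≤ B :=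
  ⟨∑ i, ‖mulL n (e i)‖, by positivity, fun i =>
    Finset.single_le_sum (f := fun i => ‖mulL n (e i)‖) (fun _ _ => norm_nonneg _)
      (Finset.mem_univ i)⟩

lemma norm_one_op_le : ‖(1 : Cl n →L[ℝ] Cl n)‖ ≤ 1 := ContinuousLinearMap.norm_id_le

/-! ### The monogenic exponential along a curve given by power series -/

section PowerSeries

variable {ρ s B : ℝ} {y : ℝ → Para n}

lemma psBound_fueterVar (hρ : 0 ≤ ρ) (hB : ∀ i : Fin n, ‖mulL n (e i)‖ ≤ B)
    (hy : ∀ k, PSBound ρ (fun t => y t k) s) (i : Fin n) :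
    PSBound ρ (fun t => mulL n (fueterVar i (y t))) (s + B * s) := by
  have h1 := (hy i.succ).map hρ (ContinuousLinearMap.toSpanSingleton ℝ (1 : Cl n →L[ℝ] Cl n))
    (M := 1) (by rw [ContinuousLinearMap.norm_toSpanSingleton]; exact norm_one_op_le)
  have h2 := (hy 0).map hρ (ContinuousLinearMap.toSpanSingleton ℝ (-mulL n (e i)))
    (M := B) (by rw [ContinuousLinearMap.norm_toSpanSingleton, norm_neg]; exact hB i)
  have h3 := h1.add h2 hρ
  rw [one_mul] at h3
  refine h3.congr (fun t => ?_) rfl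
  rw [fueterVar, map_sub, map_smul, mulL_algebraMap]
  simp [sub_eq_add_neg]

lemma psBound_fueterPoly (hρ : 0 ≤ ρ) (hB : ∀ i : Fin n, ‖mulL n (e i)‖ ≤ B)
    (hy : ∀ k, PSBound ρ (fun t => y t k) s) {k : ℕ} (ℓ : Fin k → Fin n) :
    PSBound ρ (fun t => mulL n (fueterPoly ℓ (y t))) ((s + B * s) ^ k) := by
  have h1 := fun σ : Equiv.Perm (Fin k) => PSBound.list_prod hρ norm_one_op_le
    fun i => psBound_fueterVar hρ hB hy (ℓ (σ i))
  have h2 := (PSBound.sum (s := Finset.univ) hρ fun σ _ => h1 σ).smul hρ ((k.factorial : ℝ)⁻¹)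
  refine h2.congr (fun t => ?_) ?_
  · rw [fueterPoly, map_smul, map_sum]
    simp only [mulL_list_prod, List.map_ofFn]
    rfl
  · have : (k.factorial : ℝ) ≠ 0 := by positivity
    simp [Fintype.card_perm, abs_inv, this]

lemma psBound_ckPow (hρ : 0 ≤ ρ) (hB : ∀ i : Fin n, ‖mulL n (e i)‖ ≤ B)
    (hy : ∀ k, PSBound ρ (fun t => y t k) s) (k : ℕ) :
    PSBound ρ (fun t => ckPow k (y t)) ((n * (s + B * s) * B) ^ k) := by
  have hE : ∀ ℓ : Fin k → Fin n, ‖mulL n (List.ofFn fun i => e (ℓ i)).prod‖ ≤ B ^ k := fun ℓ => by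
    -- the product bound for power series, applied to constants
    have := PSBound.list_prod (ρ := 0) le_rfl (norm_one_op_le (n := n)) (S := B)
      (Q := fun i _ => mulL n (e (ℓ i)))
      fun i => (PSBound.const _).mono (hB (ℓ i))
    have := this.norm_le (t := 0) (by simp)
    simpa only [mulL_list_prod, List.map_ofFn, Function.comp_def] using this
  have h1 := fun ℓ : Fin k → Fin n => (psBound_fueterPoly hρ hB hy ℓ).mul
    ((PSBound.const (ρ := ρ) (mulL n (List.ofFn fun i => e (ℓ i)).prod)).mono (hE ℓ)) hρ
  have h2 := (PSBound.sum (s := Finset.univ) hρ fun ℓ _ => h1 ℓ).map hρ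
    (ContinuousLinearMap.apply ℝ (Cl n) (1 : Cl n)) (M := 1)
    (ContinuousLinearMap.opNorm_le_bound _ zero_le_one fun T => by
      simpa [norm_one_cl] using T.le_opNorm 1)
  refine h2.congr (fun t => ?_) ?_
  · simp [ckPow, mulL_apply]
  · simp [mul_pow]; ring

/-- If the coordinates of `y` are power series on `[-ρ, ρ]`, so is `E ∘ y`, with an explicit bound
for its weighted norm. -/
lemma psBound_monoExp (hρ : 0 < ρ) (hB : ∀ i : Fin n, ‖mulL n (e i)‖ ≤ B)
    (hy : ∀ k, PSBound ρ (fun t => y t k) s) :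
    PSBound ρ (fun t => monoExp (y t)) (Real.exp (n * (s + B * s) * B)) := by
  have h1 := fun k : ℕ => (psBound_ckPow hρ.le hB hy k).smul hρ.le ((k.factorial : ℝ)⁻¹)
  have h2 : HasSum (fun k : ℕ => |((k.factorial : ℝ)⁻¹)| * (n * (s + B * s) * B) ^ k)
      (Real.exp (n * (s + B * s) * B)) := by
    rw [Real.exp_eq_exp_ℝ]
    refine (NormedSpace.exp_series_hasSum_exp' (𝕂 := ℝ) (n * (s + B * s) * B)).congr_fun fun k => ?_
    rw [abs_inv, Nat.abs_cast, smul_eq_mul]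
  have h3 := PSBound.tsum hρ h2.summable h1
  rw [h2.tsum_eq] at h3
  exact h3

end PowerSeries

/-! ### The monogenic exponential on a coordinate axis -/

lemma fueterPoly_of_zero {x : Para n} (hx : x 0 = 0) {k : ℕ} (ℓ : Fin k → Fin n) :
    fueterPoly ℓ x = algebraMap ℝ (Cl n) (∏ i, x (ℓ i).succ) := by
  have h : ∀ σ : Equiv.Perm (Fin k), (List.ofFn fun i => fueterVar (ℓ (σ i)) x).prod =
      algebraMap ℝ (Cl n) (∏ i, x (ℓ i).succ) := fun σ => by
    rw [← Equiv.prod_comp σ, ← List.prod_ofFn, map_list_prod, List.map_ofFn]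
    congr 2; funext i
    simp [fueterVar, hx]
  have hk : (k.factorial : ℝ) ≠ 0 := by positivity
  rw [fueterPoly, Finset.sum_congr rfl fun σ _ => h σ, Finset.sum_const, Finset.card_univ,
    Fintype.card_perm, Fintype.card_fin, ← Nat.cast_smul_eq_nsmul ℝ, smul_smul,
    inv_mul_cancel₀ hk, one_smul]

lemma ckPow_single (i : Fin n) (t : ℝ) (k : ℕ) :
    ckPow k (t • EuclideanSpace.single i.succ (1 : ℝ)) = t ^ k • e i ^ k := by
  have hx : (t • EuclideanSpace.single i.succ (1 : ℝ) : Para n) 0 = 0 := by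
    simp [(Fin.succ_ne_zero i).symm]
  rw [ckPow, Finset.sum_eq_single fun _ => i]
  · rw [fueterPoly_of_zero hx]
    simp [Algebra.algebraMap_eq_smul_one, List.ofFn_const]
  · intro ℓ _ hℓ
    obtain ⟨j, hj⟩ := Function.ne_iff.1 hℓ
    rw [fueterPoly_of_zero hx, Finset.prod_eq_zero (Finset.mem_univ j)]
    · simp
    · simp [hj]
  · simp

/-- On the axis of `e_i` the monogenic exponential is `exp (t e_i) = cos t + sin t e_i`. -/
lemma monoExp_single (i : Fin n) (t : ℝ) :
    monoExp (t • EuclideanSpace.single i.succ (1 : ℝ)) = Real.cos t • 1 + Real.sin t • e i := by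
  have he : e i ^ 2 = -1 := by rw [pow_two, e_mul_self]
  have hc := (Real.hasSum_cos t).smul_const (1 : Cl n)
  have hs := (Real.hasSum_sin t).smul_const (e i)
  refine HasSum.tsum_eq (HasSum.even_add_odd ?_ ?_)
  · refine hc.congr_fun fun k => ?_
    rw [ckPow_single, pow_mul (e i), he, smul_smul, div_eq_inv_mul, ← neg_one_smul ℝ (1 : Cl n),
      smul_pow, one_pow, smul_smul]
    congr 1; ring
  · refine hs.congr_fun fun k => ?_
    rw [ckPow_single, pow_succ (e i), pow_mul (e i), he, smul_smul, div_eq_inv_mul,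
      ← neg_one_smul ℝ (1 : Cl n), smul_pow, one_pow, smul_mul_assoc, one_mul, smul_smul]
    congr 1; ring

/-- For `n = 0` the monogenic exponential is the constant `1`. -/
lemma monoExp_zero_units (x : Para 0) : monoExp x = 1 := by
  rw [monoExp, tsum_eq_single 0]
  · simp [ckPow, fueterPoly]
  · intro k hk
    obtain ⟨m, rfl⟩ := Nat.exists_eq_succ_of_ne_zero hk
    simp [ckPow]

open MeasureTheory

/-! ### A radial bump function -/

/-- A smooth nonnegative radial function supported in the unit ball. -/
def bump (n : ℕ) (y : Para n) : ℝ := Real.smoothTransition (1 - ‖y‖ ^ 2)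

lemma contDiff_bump {m : ℕ∞} : ContDiff ℝ m (bump n) :=
  Real.smoothTransition.contDiff.comp (contDiff_const.sub (contDiff_norm_sq ℝ))

lemma continuous_bump : Continuous (bump n) := (contDiff_bump (m := 0)).continuous

lemma bump_nonneg (y : Para n) : 0 ≤ bump n y := Real.smoothTransition.nonneg _

lemma bump_neg (y : Para n) : bump n (-y) = bump n y := by simp [bump]

lemma tsupport_bump : tsupport (bump n) ⊆ Metric.closedBall 0 1 := by
  refine closure_minimal (fun y hy => ?_) Metric.isClosed_closedBall
  rw [mem_closedBall_zero_iff]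
  by_contra! h
  exact hy (Real.smoothTransition.zero_of_nonpos (by nlinarith))

lemma hasCompactSupport_bump : HasCompactSupport (bump n) :=
  (isCompact_closedBall 0 1).of_isClosed_subset (isClosed_tsupport _) tsupport_bump

lemma integral_bump_pos : 0 < ∫ y, bump n y :=
  continuous_bump.integral_pos_of_hasCompactSupport_nonneg_nonzero hasCompactSupport_bump
    bump_nonneg (x := 0) (by simp [bump])

/-- The gradient of the radial function `bump` is a multiple of the position vector. -/
lemma exists_fderiv_bump (y : Para n) :
    ∃ d : ℝ, ∀ k, fderiv ℝ (bump n) y (EuclideanSpace.single k 1) = d * y k := by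
  have h1 : HasFDerivAt (fun y : Para n => 1 - ‖y‖ ^ 2) (-(2 • innerSL ℝ y)) y :=
    (hasStrictFDerivAt_norm_sq y).hasFDerivAt.const_sub 1
  have h2 : DifferentiableAt ℝ Real.smoothTransition (1 - ‖y‖ ^ 2) :=
    (Real.smoothTransition.contDiffAt (n := 1)).differentiableAt one_ne_zero
  have h3 := h2.hasDerivAt.comp_hasFDerivAt y h1
  refine ⟨-(deriv Real.smoothTransition (1 - ‖y‖ ^ 2) * 2), fun k => ?_⟩
  rw [show bump n = Real.smoothTransition ∘ fun y : Para n => 1 - ‖y‖ ^ 2 from rfl, h3.fderiv]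
  simp [EuclideanSpace.inner_single_right]
  ring

lemma integrable_bump_smul {F : Para n → Cl n} (hF : Continuous F) :
    Integrable fun y => bump n y • F y :=
  (continuous_bump.smul hF).integrable_of_hasCompactSupport hasCompactSupport_bump.smul_right

/-! ### The mean value property of monogenic functions -/

/-- The rotation `x_i ∂_j - x_j ∂_i` is skew-symmetric and annihilates radial functions. -/
lemma integral_bump_coord_partialDeriv_comm {v : Para n → Cl n} (hv : ContDiff ℝ 1 v)
    (i j : Fin (n + 1)) :
    ∫ y, bump n y • (y i • partialDeriv j v y) = ∫ y, bump n y • (y j • partialDeriv i v y) := by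
  have hc : ∀ k : Fin (n + 1), ContDiff ℝ 1 fun y : Para n => bump n y * y k := fun k =>
    (contDiff_bump (m := 1)).mul (EuclideanSpace.proj (𝕜 := ℝ) k).contDiff
  have hsupp : ∀ k : Fin (n + 1), HasCompactSupport fun y : Para n => bump n y * y k := fun k =>
    hasCompactSupport_bump.mul_right
  have parts : ∀ k l : Fin (n + 1), ∫ y, bump n y • (y k • partialDeriv l v y) =
      -∫ y : Para n,
        fderiv ℝ (fun y : Para n => bump n y * y k) y (EuclideanSpace.single l 1) • v y := by
    intro k l
    have hd : Continuous fun y => fderiv ℝ v y (EuclideanSpace.single l 1) :=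
      (hv.continuous_fderiv one_ne_zero).clm_apply continuous_const
    have hd' : Continuous fun y : Para n =>
        fderiv ℝ (fun y : Para n => bump n y * y k) y (EuclideanSpace.single l 1) :=
      ((hc k).continuous_fderiv one_ne_zero).clm_apply continuous_const
    rw [← integral_smul_fderiv_eq_neg_fderiv_smul_of_integrable]
    · simp only [smul_smul, partialDeriv]
    · exact (hd'.smul hv.continuous).integrable_of_hasCompactSupport
        (((hsupp k).fderiv_apply ℝ _).smul_right)
    · exact ((hc k).continuous.smul hd).integrable_of_hasCompactSupport (hsupp k).smul_right
    · exact ((hc k).continuous.smul hv.continuous).integrable_of_hasCompactSupport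
        (hsupp k).smul_right
    · exact fun y _ => ((hc k).differentiable one_ne_zero) y
    · exact fun y _ => (hv.differentiable one_ne_zero) y
  rw [parts, parts]
  congr 2
  funext y
  congr 1
  have hf : ∀ k l : Fin (n + 1), fderiv ℝ (fun y : Para n => bump n y * y k) y
      (EuclideanSpace.single l 1) =
      bump n y * (if k = l then 1 else 0) +
        y k * fderiv ℝ (bump n) y (EuclideanSpace.single l 1) := by
    intro k l
    have h1 := ((contDiff_bump (n := n) (m := 1)).differentiable one_ne_zero y).hasFDerivAt.mul
      (EuclideanSpace.proj (𝕜 := ℝ) k : Para n →L[ℝ] ℝ).hasFDerivAt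
    rw [show (fun y : Para n => bump n y * y k) =
      (bump n * (EuclideanSpace.proj (𝕜 := ℝ) k : Para n →L[ℝ] ℝ)) from rfl, h1.fderiv]
    simp
  obtain ⟨d, hd⟩ := exists_fderiv_bump y
  rw [hf, hf, hd, hd]
  simp only [eq_comm (a := i)]
  ring

/-- The paravector units `e_0 = 1, e_1, …, e_n`. -/
def paraUnit (i : Fin (n + 1)) : Cl n := Fin.cases 1 e i

/-- The conjugates `1, -e_1, …, -e_n` of the paravector units. -/
def paraUnitConj (i : Fin (n + 1)) : Cl n := Fin.cases 1 (fun i => -e i) i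

lemma paraUnitConj_mul_add (i j : Fin (n + 1)) :
    paraUnitConj i * paraUnit j + paraUnitConj j * paraUnit i =
      if i = j then (2 : ℝ) • (1 : Cl n) else 0 := by
  cases i using Fin.cases with
  | zero => cases j using Fin.cases with
    | zero => simp [paraUnit, paraUnitConj, two_smul]
    | succ j => simp [paraUnit, paraUnitConj, (Fin.succ_ne_zero j).symm]
  | succ i => cases j using Fin.cases with
    | zero => simp [paraUnit, paraUnitConj, Fin.succ_ne_zero i]
    | succ j =>
      by_cases h : i = j
      · subst h; simp [paraUnit, paraUnitConj, e_mul_self, two_smul]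
      · simp [paraUnit, paraUnitConj, h, e_mul_e h]

lemma IsEntireMonogenic.sum_paraUnit {v : Para n → Cl n} (hv : IsEntireMonogenic v) (y : Para n) :
    ∑ j, paraUnit j * partialDeriv j v y = 0 := by
  rw [Fin.sum_univ_succ]
  simpa [paraUnit] using hv.2 y

lemma fderiv_apply_eq_sum {v : Para n → Cl n} (x y : Para n) :
    fderiv ℝ v x y = ∑ i, y i • partialDeriv i v x := by
  have hy : y = ∑ i, y i • EuclideanSpace.single i (1 : ℝ) := by
    ext k; simp [Finset.sum_apply, Pi.single_apply]
  conv_lhs => rw [hy]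
  simp only [map_sum, map_smul, partialDeriv]

/-- For a monogenic `v` the radial derivative is a combination, with constant Clifford
coefficients, of the rotations `x_i ∂_j - x_j ∂_i` applied to `v`, so radial weights kill it. -/
lemma IsEntireMonogenic.integral_bump_radial {v : Para n → Cl n} (hv : IsEntireMonogenic v) :
    ∫ y, bump n y • fderiv ℝ v y y = 0 := by
  set J : Fin (n + 1) → Fin (n + 1) → Cl n := fun i j =>
    ∫ y, bump n y • (y i • partialDeriv j v y) with hJ
  have hJc : ∀ i j, J i j = J j i := integral_bump_coord_partialDeriv_comm hv.1
  have hcont : ∀ i j : Fin (n + 1), Continuous fun y : Para n => y i • partialDeriv j v y :=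
    fun i j => (EuclideanSpace.proj (𝕜 := ℝ) i : Para n →L[ℝ] ℝ).continuous.smul
      ((hv.1.continuous_fderiv one_ne_zero).clm_apply continuous_const)
  have hint : ∀ i j, Integrable fun y : Para n => bump n y • (y i • partialDeriv j v y) :=
    fun i j => integrable_bump_smul (hcont i j)
  have h1 : ∫ y, bump n y • fderiv ℝ v y y = ∑ i, J i i := by
    simp only [fderiv_apply_eq_sum, Finset.smul_sum]
    exact integral_finsetSum _ fun i _ => hint i i
  have h2 : ∑ i, ∑ j, paraUnitConj i * paraUnit j * J i j = 0 := by
    have h3 : ∀ i j, paraUnitConj i * paraUnit j * J i j =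
        ∫ y, mulL n (paraUnitConj i * paraUnit j) (bump n y • (y i • partialDeriv j v y)) :=
      fun i j => ((mulL n (paraUnitConj i * paraUnit j)).integral_comp_comm (hint i j)).symm
    refine Finset.sum_eq_zero fun i _ => ?_
    simp only [h3]
    rw [← integral_finsetSum _ fun j _ =>
      (mulL n (paraUnitConj i * paraUnit j)).integrable_comp (hint i j)]
    refine integral_eq_zero_of_ae (Eventually.of_forall fun y => ?_)
    have := hv.sum_paraUnit y
    calc _ = (bump n y * y i) • (paraUnitConj i * ∑ j, paraUnit j * partialDeriv j v y) := by
          simp only [map_smul, mulL_apply, Finset.mul_sum, Finset.smul_sum, smul_smul, mul_assoc]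
      _ = 0 := by rw [this, mul_zero, smul_zero]
  have h4 : ∑ i, ∑ j, paraUnitConj j * paraUnit i * J i j = 0 := by
    rw [Finset.sum_comm, ← h2]
    exact Finset.sum_congr rfl fun i _ => Finset.sum_congr rfl fun j _ => by rw [hJc i j]
  have h5 : (2 : ℝ) • ∑ i, J i i = 0 := by
    rw [← add_zero (0 : Cl n)]
    nth_rw 1 [← h2]
    rw [← h4, ← Finset.sum_add_distrib, Finset.smul_sum]
    refine Finset.sum_congr rfl fun i _ => ?_
    rw [← Finset.sum_add_distrib]
    simp only [← add_mul, paraUnitConj_mul_add]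
    simp
  rw [h1]
  exact (smul_eq_zero.1 h5).resolve_left two_ne_zero

lemma fderiv_comp_affine {u : Para n → Cl n} (hu : ContDiff ℝ 1 u) (x : Para n) (r : ℝ)
    (y : Para n) : fderiv ℝ (fun y => u (x + r • y)) y = r • fderiv ℝ u (x + r • y) := by
  have h1 : HasFDerivAt (fun y : Para n => x + r • y) (r • ContinuousLinearMap.id ℝ (Para n)) y :=
    ((hasFDerivAt_id y).const_smul r).const_add x
  have h2 := ((hu.differentiable one_ne_zero) (x + r • y)).hasFDerivAt.comp y h1
  rw [show (fun y => u (x + r • y)) = u ∘ fun y => x + r • y from rfl, h2.fderiv]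
  ext; simp

lemma IsEntireMonogenic.comp_affine {u : Para n → Cl n} (hu : IsEntireMonogenic u) (x : Para n)
    (r : ℝ) : IsEntireMonogenic fun y => u (x + r • y) := by
  refine ⟨hu.1.comp (by fun_prop), fun y => ?_⟩
  simp only [partialDeriv, fderiv_comp_affine hu.1, smul_apply, mul_smul_comm]
  rw [← Finset.smul_sum, ← smul_add]
  simpa [partialDeriv] using congrArg (r • ·) (hu.2 (x + r • y))

lemma IsEntireMonogenic.integral_bump_radial_affine {u : Para n → Cl n}
    (hu : IsEntireMonogenic u) (x : Para n) (r : ℝ) :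
    ∫ y, bump n y • fderiv ℝ u (x + r • y) y = 0 := by
  -- for `r ≠ 0` this is `integral_bump_radial` for `y ↦ u (x + r y)`, divided by `r`
  rcases eq_or_ne r 0 with rfl | hr
  · -- the integrand is odd
    have h := integral_neg_eq_self (fun y : Para n => bump n y • fderiv ℝ u x y) volume
    simp only [bump_neg, map_neg, smul_neg, integral_neg] at h
    have h2 : (2 : ℝ) • ∫ y : Para n, bump n y • fderiv ℝ u x y = 0 := by
      rw [two_smul]; nth_rw 1 [← h]; exact neg_add_cancel _
    simpa using h2
  · have h := (hu.comp_affine x r).integral_bump_radial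
    simp only [fderiv_comp_affine hu.1, smul_apply, smul_comm _ r,
      integral_smul] at h
    exact (smul_eq_zero.1 h).resolve_left hr

lemma hasDerivAt_integral_bump {u : Para n → Cl n} (hu : ContDiff ℝ 1 u) (x : Para n) (r : ℝ) :
    HasDerivAt (fun r : ℝ => ∫ y, bump n y • u (x + r • y))
      (∫ y, bump n y • fderiv ℝ u (x + r • y) y) r := by
  have hc' : Continuous fun p : ℝ × Para n => fderiv ℝ u (x + p.1 • p.2) p.2 :=
    ((hu.continuous_fderiv one_ne_zero).comp (by fun_prop)).clm_apply continuous_snd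
  obtain ⟨M, hM⟩ := ((isCompact_closedBall r 1).prod
    (isCompact_closedBall (0 : Para n) 1)).exists_bound_of_continuousOn hc'.continuousOn
  refine (hasDerivAt_integral_of_dominated_loc_of_deriv_le (bound := fun y => bump n y * M)
    (F' := fun r y => bump n y • fderiv ℝ u (x + r • y) y)
    (Metric.ball_mem_nhds r one_pos) (Eventually.of_forall fun r => ?_) ?_ ?_ ?_ ?_ ?_).2
  · exact (integrable_bump_smul (hu.continuous.comp (by fun_prop))).aestronglyMeasurable
  · exact integrable_bump_smul (hu.continuous.comp (by fun_prop))
  · exact (integrable_bump_smul (hc'.comp (by fun_prop : Continuous fun y : Para n =>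
      (r, y)))).aestronglyMeasurable
  · refine Eventually.of_forall fun y r' hr' => ?_
    by_cases hy : y ∈ tsupport (bump n)
    · rw [norm_smul, Real.norm_of_nonneg (bump_nonneg y)]
      exact mul_le_mul_of_nonneg_left
        (hM (r', y) ⟨Metric.ball_subset_closedBall hr', tsupport_bump hy⟩) (bump_nonneg y)
    · simp [image_eq_zero_of_notMem_tsupport hy]
  · exact (continuous_bump.integrable_of_hasCompactSupport hasCompactSupport_bump).mul_const M
  · refine Eventually.of_forall fun y r' _ => ?_
    have h1 : HasDerivAt (fun r : ℝ => x + r • y) y r' := by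
      simpa using ((hasDerivAt_id r').smul_const y).const_add x
    exact (((hu.differentiable one_ne_zero) (x + r' • y)).hasFDerivAt.comp_hasDerivAt r'
      h1).const_smul (bump n y)

/-- The mean value property: `r ↦ ∫ bump y • u (x + r y)` is constant; compare `r = -1` and
`r = 0`. -/
lemma IsEntireMonogenic.integral_bump_smul_eq {u : Para n → Cl n} (hu : IsEntireMonogenic u)
    (x : Para n) : ∫ y, bump n y • u (x - y) = (∫ y, bump n y) • u x := by
  have hd := fun r => hasDerivAt_integral_bump hu.1 x r
  have h := is_const_of_deriv_eq_zero (fun r => (hd r).differentiableAt)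
    (fun r => by rw [(hd r).deriv, hu.integral_bump_radial_affine]) (-1) 0
  simpa [sub_eq_add_neg, integral_smul_const] using h

/-! ### Differentiation in the spaces of bounded exponential type -/

open scoped Convolution in
lemma IsEntireMonogenic.eq_convolution {u : Para n → Cl n} (hu : IsEntireMonogenic u) :
    u = (∫ y, bump n y)⁻¹ • (u ⋆[(ContinuousLinearMap.lsmul ℝ ℝ).flip, volume] bump n) := by
  funext x
  have h := hu.integral_bump_smul_eq x
  rw [Pi.smul_apply, convolution_eq_swap]
  simp only [ContinuousLinearMap.flip_apply, ContinuousLinearMap.lsmul_apply]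
  rw [h, smul_smul, inv_mul_cancel₀ integral_bump_pos.ne', one_smul]

lemma IsEntireMonogenic.contDiff {u : Para n → Cl n} (hu : IsEntireMonogenic u) {m : ℕ∞} :
    ContDiff ℝ m u := by
  rw [hu.eq_convolution]
  exact (hasCompactSupport_bump.contDiff_convolution_right (μ := volume)
    (ContinuousLinearMap.lsmul ℝ ℝ : ℝ →L[ℝ] Cl n →L[ℝ] Cl n).flip
    hu.1.continuous.locallyIntegrable contDiff_bump).const_smul (∫ y, bump n y)⁻¹

lemma IsEntireMonogenic.fderiv_apply_eq {u : Para n → Cl n} (hu : IsEntireMonogenic u)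
    (v x : Para n) :
    fderiv ℝ u x v = (∫ y, bump n y)⁻¹ • ∫ y, fderiv ℝ (bump n) y v • u (x - y) := by
  have h1 := hasCompactSupport_bump.hasFDerivAt_convolution_right
    (μ := volume) (ContinuousLinearMap.lsmul ℝ ℝ : ℝ →L[ℝ] Cl n →L[ℝ] Cl n).flip
    hu.1.continuous.locallyIntegrable (contDiff_bump (m := 1)) x
  conv_lhs => rw [hu.eq_convolution, (h1.const_smul _).fderiv]
  rw [smul_apply,
    convolution_precompR_apply _ hu.1.continuous.locallyIntegrable
      (hasCompactSupport_bump.fderiv ℝ) ((contDiff_bump (m := 1)).continuous_fderiv one_ne_zero),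
    convolution_eq_swap]
  rfl

/-- Directional derivatives of monogenic functions are monogenic. -/
lemma IsEntireMonogenic.fderiv_apply {u : Para n → Cl n} (hu : IsEntireMonogenic u) (v : Para n) :
    IsEntireMonogenic fun x => fderiv ℝ u x v := by
  have h2 : ContDiff ℝ 2 u := hu.contDiff (m := 2)
  have hd : ContDiff ℝ 1 (fderiv ℝ u) := h2.fderiv_right (by norm_num)
  refine ⟨hd.clm_apply contDiff_const, fun x => ?_⟩
  have hdx := (hd.differentiable one_ne_zero) x
  have hsymm : ∀ k, partialDeriv k (fun x => fderiv ℝ u x v) x =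
      fderiv ℝ (fun x => partialDeriv k u x) x v := fun k => by
    have := (h2.contDiffAt (x := x)).isSymmSndFDerivAt (by simp)
    simp only [partialDeriv]
    rw [fderiv_clm_apply hdx (differentiableAt_const _),
      fderiv_clm_apply hdx (differentiableAt_const _)]
    simpa using this (EuclideanSpace.single k 1) v
  have hp : ∀ k, DifferentiableAt ℝ (fun x => partialDeriv k u x) x := fun k =>
    hdx.clm_apply (differentiableAt_const _)
  have hm : ∀ i : Fin n, HasFDerivAt (fun x => e i * partialDeriv i.succ u x)
      ((mulL n (e i)).comp (fderiv ℝ (fun x => partialDeriv i.succ u x) x)) x := fun i =>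
    (mulL n (e i)).hasFDerivAt.comp x (hp i.succ).hasFDerivAt
  have hz : HasFDerivAt
      (fun x => partialDeriv 0 u x + ∑ i : Fin n, e i * partialDeriv i.succ u x) _ x :=
    (hp 0).hasFDerivAt.add (HasFDerivAt.fun_sum (u := Finset.univ) fun i _ => hm i)
  have h0 := hz.unique ((hasFDerivAt_const (0 : Cl n) x).congr_of_eventuallyEq
    (Eventually.of_forall hu.2))
  simpa [hsymm, mulL_apply] using congrArg (fun T : Para n →L[ℝ] Cl n => T v) h0

/-- Directional derivatives are bounded operators for the norm `sup |u(x)| e^{-σ|x|}`: this is the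
gradient estimate on unit balls, over which `e^{σ|x|}` varies only by the factor `e^σ`. -/
lemma exists_norm_fderiv_le (v : Para n) {σ : ℝ} (hσ : 0 ≤ σ) : ∃ K : ℝ, 0 ≤ K ∧
    ∀ (u : Para n → Cl n) (ε : ℝ), IsEntireMonogenic u →
      (∀ x, ‖u x‖ ≤ ε * Real.exp (σ * ‖x‖)) →
      ∀ x, ‖fderiv ℝ u x v‖ ≤ K * ε * Real.exp (σ * ‖x‖) := by
  have hc := integral_bump_pos (n := n)
  have hcont : Continuous fun y => fderiv ℝ (bump n) y v :=
    ((contDiff_bump (m := 1)).continuous_fderiv one_ne_zero).clm_apply continuous_const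
  have hsupp : HasCompactSupport fun y => fderiv ℝ (bump n) y v :=
    hasCompactSupport_bump.fderiv_apply ℝ v
  have hint := (hcont.integrable_of_hasCompactSupport hsupp (μ := volume)).norm
  refine ⟨(∫ y, bump n y)⁻¹ * (∫ y, ‖fderiv ℝ (bump n) y v‖) * Real.exp σ, by positivity,
    fun u ε hu hε x => ?_⟩
  have hε0 : 0 ≤ ε := by
    have := (norm_nonneg _).trans (hε 0)
    simpa using this
  have hle : ∀ y, ‖fderiv ℝ (bump n) y v • u (x - y)‖ ≤
      ‖fderiv ℝ (bump n) y v‖ * (ε * Real.exp (σ * (‖x‖ + 1))) := fun y => by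
    by_cases hy : y ∈ tsupport (bump n)
    · rw [norm_smul]
      have hy1 := mem_closedBall_zero_iff.1 (tsupport_bump hy)
      have : ‖x - y‖ ≤ ‖x‖ + 1 := (norm_sub_le x y).trans (by gcongr)
      refine mul_le_mul_of_nonneg_left ((hε _).trans ?_) (norm_nonneg _)
      gcongr
    · have : fderiv ℝ (bump n) y = 0 := by
        by_contra h
        exact hy (support_fderiv_subset ℝ h)
      simp [this]
  rw [hu.fderiv_apply_eq, norm_smul, norm_inv, Real.norm_of_nonneg hc.le]
  calc _ ≤ (∫ y, bump n y)⁻¹ *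
        ∫ y, ‖fderiv ℝ (bump n) y v‖ * (ε * Real.exp (σ * (‖x‖ + 1))) := by
        gcongr
        exact norm_integral_le_of_norm_le (hint.mul_const _) (Eventually.of_forall hle)
    _ = _ := by
        rw [integral_mul_const, mul_add, Real.exp_add, mul_one]; ring

/-! ### Moments of a convergent sequence of exponential sums -/

/-- The function `t ↦ exp (h t e_i) w` has derivative `exp (h t e_i) (h e_i w)`. -/
lemma hasDerivAt_cos_add_sin_mul (i : Fin n) (h : ℝ) (w : Cl n) (t : ℝ) :
    HasDerivAt (fun t : ℝ => (Real.cos (h * t) • 1 + Real.sin (h * t) • e i) * w)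
      ((Real.cos (h * t) • 1 + Real.sin (h * t) • e i) * (h • (e i * w))) t := by
  have hl : HasDerivAt (fun t : ℝ => h * t) h t := by simpa using (hasDerivAt_id t).const_mul h
  have h1 := (hl.cos.smul_const (1 : Cl n)).add (hl.sin.smul_const (e i))
  have h2 := ((mulL n).flip w).hasFDerivAt.comp_hasDerivAt t h1
  have h3 : (Real.cos (h * t) • 1 + Real.sin (h * t) • e i) * (h • (e i * w)) =
      (mulL n).flip w ((-Real.sin (h * t) * h) • 1 + (Real.cos (h * t) * h) • e i) := by
    simp only [ContinuousLinearMap.flip_apply, mulL_apply, add_mul, smul_mul_assoc, one_mul,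
      mul_smul_comm, ← mul_assoc, e_mul_self, neg_mul]
    module
  rw [h3]
  exact h2

/-- A finite combination of exponentials `E(h x) w`. Its directional derivatives of order `k` at the
origin, along `e_i`, are the moments `∑ h^k e_i^k w`; hence the moments `∑ h^k w` grow at most
geometrically, at a rate that does not depend on the combination. -/
lemma exists_norm_moment_le (i : Fin n) {σ : ℝ} (hσ : 0 ≤ σ) : ∃ K : ℝ, 0 ≤ K ∧
    ∀ (s : Finset ℕ) (h : ℕ → ℝ) (w : ℕ → Cl n) (ε : ℝ),
      IsEntireMonogenic (fun x => ∑ j ∈ s, monoExp (h j • x) * w j) →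
      (∀ x, ‖∑ j ∈ s, monoExp (h j • x) * w j‖ ≤ ε * Real.exp (σ * ‖x‖)) →
      ∀ k : ℕ, ‖∑ j ∈ s, h j ^ k • w j‖ ≤ K ^ k * ε := by
  set v : Para n := EuclideanSpace.single i.succ 1 with hv
  obtain ⟨K, hK0, hK⟩ := exists_norm_fderiv_le v hσ
  refine ⟨‖mulL n (e i)‖ * K, by positivity, fun s h w ε hu hε k => ?_⟩
  set u : Para n → Cl n := fun x => ∑ j ∈ s, monoExp (h j • x) * w j with hu_def
  let D : ℕ → Para n → Cl n := fun k => (fun f x => fderiv ℝ f x v)^[k] u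
  have hD : ∀ k x, D (k + 1) x = fderiv ℝ (D k) x v := fun k x => by
    simp only [D, Function.iterate_succ_apply']
  have hmono : ∀ k, IsEntireMonogenic (D k) := fun k => by
    induction k with
    | zero => exact hu
    | succ k ih => rw [funext (hD k)]; exact ih.fderiv_apply v
  have hbound : ∀ k x, ‖D k x‖ ≤ K ^ k * ε * Real.exp (σ * ‖x‖) := fun k => by
    induction k with
    | zero => intro x; rw [pow_zero, one_mul]; exact hε x
    | succ k ih =>
      intro x
      rw [hD, pow_succ', mul_assoc K]
      exact hK _ _ (hmono k) ih x
  have hline : ∀ k (t : ℝ), D k (t • v) =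
      ∑ j ∈ s, (Real.cos (h j * t) • 1 + Real.sin (h j * t) • e i) *
        (h j ^ k • (e i ^ k * w j)) := fun k => by
    induction k with
    | zero =>
      intro t
      change ∑ j ∈ s, monoExp (h j • t • v) * w j = _
      refine Finset.sum_congr rfl fun j _ => ?_
      rw [smul_smul, hv, monoExp_single]; simp
    | succ k ih =>
      intro t
      have h1 : HasDerivAt (fun t : ℝ => t • v) v t := by
        simpa using (hasDerivAt_id t).smul_const v
      have h2 := (((hmono k).1.differentiable one_ne_zero) (t • v)).hasFDerivAt.comp_hasDerivAt t h1
      have h3 := HasDerivAt.fun_sum (u := s) fun j _ =>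
        hasDerivAt_cos_add_sin_mul i (h j) (h j ^ k • (e i ^ k * w j)) t
      rw [hD, h2.unique (h3.congr_of_eventuallyEq (Eventually.of_forall ih))]
      refine Finset.sum_congr rfl fun j _ => ?_
      rw [mul_smul_comm (h j ^ k), smul_smul, ← mul_assoc (e i), ← pow_succ', ← pow_succ']
  have h0 : D k 0 = e i ^ k * ∑ j ∈ s, h j ^ k • w j := by
    have := hline k 0
    rw [zero_smul] at this
    rw [this, Finset.mul_sum]
    exact Finset.sum_congr rfl fun j _ => by simp
  -- `e_i` is invertible, with inverse `-e_i`, so it can be cancelled at a geometric cost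
  have hinv : ∀ (k : ℕ) (y : Cl n), ‖y‖ ≤ ‖mulL n (e i)‖ ^ k * ‖e i ^ k * y‖ := fun k => by
    induction k with
    | zero => intro y; simp
    | succ k ih =>
      intro y
      have h1 : ‖e i ^ k * y‖ ≤ ‖mulL n (e i)‖ * ‖e i ^ (k + 1) * y‖ := by
        have : e i ^ k * y = -(mulL n (e i) (e i ^ (k + 1) * y)) := by
          rw [mulL_apply, pow_succ', ← mul_assoc, ← mul_assoc, e_mul_self]; simp
        rw [this, norm_neg]
        exact (mulL n (e i)).le_opNorm _
      calc _ ≤ _ := ih y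
        _ ≤ ‖mulL n (e i)‖ ^ k * (‖mulL n (e i)‖ * ‖e i ^ (k + 1) * y‖) := by gcongr
        _ = _ := by ring
  calc _ ≤ _ := hinv k _
    _ ≤ ‖mulL n (e i)‖ ^ k * (K ^ k * ε) := by
        gcongr
        rw [← h0]; simpa using hbound k 0
    _ = _ := by ring

/-! ### Convergence of the transformed sequence -/

lemma IsEntireMonogenic.sub {u v : Para n → Cl n} (hu : IsEntireMonogenic u)
    (hv : IsEntireMonogenic v) : IsEntireMonogenic fun x => u x - v x := by
  refine ⟨hu.1.sub hv.1, fun x => ?_⟩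
  have h : ∀ k, partialDeriv k (fun x => u x - v x) x = partialDeriv k u x - partialDeriv k v x :=
    fun k => by
      simp only [partialDeriv]
      rw [fderiv_fun_sub (hu.1.differentiable one_ne_zero x) (hv.1.differentiable one_ne_zero x)]
      rfl
  simp only [h, mul_sub, Finset.sum_sub_distrib]
  rw [sub_add_sub_comm, hu.2, hv.2, sub_zero]

lemma norm_sub_le_normA {σ : ℝ} {u v : Para n → Cl n} (hu : MemA σ u) (hv : MemA σ v)
    (x : Para n) : ‖u x - v x‖ ≤ normA σ (u - v) * Real.exp (σ * ‖x‖) := by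
  have hbdd : BddAbove (Set.range fun x => ‖(u - v) x‖ * Real.exp (-σ * ‖x‖)) := by
    obtain ⟨A, hA⟩ := hu.2
    obtain ⟨B, hB⟩ := hv.2
    refine ⟨A + B, ?_⟩
    rintro _ ⟨y, rfl⟩
    have h1 := hA ⟨y, rfl⟩
    have h2 := hB ⟨y, rfl⟩
    calc _ ≤ (‖u y‖ + ‖v y‖) * Real.exp (-σ * ‖y‖) := by
          dsimp only
          gcongr
          exact norm_sub_le _ _
      _ ≤ A + B := by rw [add_mul]; exact add_le_add h1 h2
  have h := le_ciSup hbdd x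
  calc ‖u x - v x‖ = ‖(u - v) x‖ * Real.exp (-σ * ‖x‖) * Real.exp (σ * ‖x‖) := by
        rw [mul_assoc, ← Real.exp_add]; simp
    _ ≤ _ := by gcongr; exact h

/-- For `n ≥ 1`, closeness of `∑ E(h_j x) Z_j` to `E(a x)` in `A_{1,σ}` makes the moments
`∑ h_j^k Z_j` close to `a^k`, with a geometric loss in `k`. -/
lemma exists_norm_moment_sub_le (i : Fin n) {σ : ℝ} (hσ : 0 ≤ σ) : ∃ K : ℝ, 0 ≤ K ∧
    ∀ (N : ℕ) (a : ℝ) (h : ℕ → ℝ) (Z : ℕ → Cl n),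
      MemA σ (fun x => ∑ j ∈ Finset.range (N + 1), monoExp (h j • x) * Z j) →
      MemA σ (fun x : Para n => monoExp (a • x)) →
      ∀ k : ℕ, ‖∑ j ∈ Finset.range (N + 1), h j ^ k • Z j - a ^ k • 1‖ ≤
        K ^ k * normA σ ((fun x => ∑ j ∈ Finset.range (N + 1), monoExp (h j • x) * Z j) -
          fun x : Para n => monoExp (a • x)) := by
  obtain ⟨K, hK0, hK⟩ := exists_norm_moment_le i hσ
  refine ⟨K, hK0, fun N a h Z hf hg k => ?_⟩
  -- the difference is one more exponential sum, with the extra frequency `a` and coefficient `-1`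
  set h' : ℕ → ℝ := fun j => if j ≤ N then h j else a with hh'
  set w : ℕ → Cl n := fun j => if j ≤ N then Z j else -1 with hw
  have hsplit : ∀ F : ℝ → Cl n → Cl n, ∑ j ∈ Finset.range (N + 2), F (h' j) (w j) =
      ∑ j ∈ Finset.range (N + 1), F (h j) (Z j) + F a (-1) := fun F => by
    rw [Finset.sum_range_succ]
    congr 1
    · refine Finset.sum_congr rfl fun j hj => ?_
      have : j ≤ N := Nat.lt_succ_iff.1 (Finset.mem_range.1 hj)
      simp [hh', hw, this]
    · simp [hh', hw]
  have hdiff : ∀ x : Para n, ∑ j ∈ Finset.range (N + 2), monoExp (h' j • x) * w j =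
      ∑ j ∈ Finset.range (N + 1), monoExp (h j • x) * Z j - monoExp (a • x) := fun x => by
    rw [hsplit fun r z => monoExp (r • x) * z]; simp [sub_eq_add_neg]
  have := hK (Finset.range (N + 2)) h' w _ (by simp only [hdiff]; exact hf.1.sub hg.1)
    (fun x => by rw [hdiff]; exact norm_sub_le_normA hf hg x) k
  rwa [hsplit fun r z => r ^ k • z, smul_neg, ← sub_eq_add_neg] at this

/-- Replacing the powers of the frequencies by a power series `q`: the error is controlled by the
errors of the moments and the weighted norm of `q`. -/
lemma norm_sum_mul_sub_le {ρ S ε a : ℝ} {q : ℝ → Cl n} (hq : PSBound ρ q S)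
    (hε : 0 ≤ ε) {s : Finset ℕ} {h : ℕ → ℝ} {Z : ℕ → Cl n} (hh : ∀ j ∈ s, |h j| ≤ ρ)
    (ha : |a| ≤ ρ) (hM : ∀ k : ℕ, ‖∑ j ∈ s, h j ^ k • Z j - a ^ k • 1‖ ≤ ρ ^ k * ε) :
    ‖∑ j ∈ s, Z j * q (h j) - q a‖ ≤ ‖mulL n‖ * S * ε := by
  obtain ⟨c, h1, h2, h3⟩ := hq
  have hsum : HasSum (fun l => (∑ j ∈ s, h j ^ l • Z j - a ^ l • 1) * c l)
      (∑ j ∈ s, Z j * q (h j) - q a) := by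
    have h4 := (hasSum_sum fun j hj => (h3 (h j) (hh j hj)).mapL (mulL n (Z j))).sub (h3 a ha)
    refine h4.congr_fun fun l => ?_
    simp only [mulL_apply, sub_mul, Finset.sum_mul, smul_mul_assoc, one_mul, mul_smul_comm]
  rw [← hsum.tsum_eq]
  refine (tsum_of_norm_bounded (h1.hasSum.mul_left (‖mulL n‖ * ε)) fun l => ?_).trans ?_
  · calc _ ≤ ‖mulL n‖ * (ρ ^ l * ε) * ‖c l‖ := by
          refine (norm_mul_le_mulL _ _).trans ?_
          gcongr
          exact hM l
      _ = _ := by ring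
  · calc _ ≤ ‖mulL n‖ * ε * S := by gcongr
      _ = _ := by ring

lemma psBound_of_hasSum {g : ℝ → ℝ} {c : ℕ → ℝ} (hg : ∀ t, HasSum (fun l : ℕ => c l * t ^ l) (g t))
    {ρ : ℝ} (hρ : 0 ≤ ρ) : PSBound ρ g (∑' l, ‖c l‖ * ρ ^ l) := by
  refine ⟨c, (hg ρ).summable.norm.congr fun l => ?_, le_rfl, fun t _ => ?_⟩
  · rw [norm_mul, norm_pow, Real.norm_of_nonneg hρ]
  · simpa only [smul_eq_mul, mul_comm] using hg t

lemma continuous_of_hasSum {g : ℝ → ℝ} {c : ℕ → ℝ}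
    (hg : ∀ t, HasSum (fun l : ℕ => c l * t ^ l) (g t)) : Continuous g := by
  rw [continuous_iff_continuousAt]
  intro t
  have hs := (hg (|t| + 1)).summable.norm
  have h : ContinuousOn g (Metric.ball 0 (|t| + 1)) := by
    rw [show g = fun t => ∑' l, c l * t ^ l from funext fun t => (hg t).tsum_eq.symm]
    refine continuousOn_tsum (fun l => by fun_prop) hs fun l x hx => ?_
    rw [norm_mul, norm_mul, norm_pow, norm_pow, Real.norm_of_nonneg (r := |t| + 1) (by positivity)]
    gcongr
    exact (mem_ball_zero_iff.1 hx).le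
  exact h.continuousAt (Metric.isOpen_ball.mem_nhds (by simp))

lemma scale_hasSum {g : Fin (n + 1) → ℝ → ℝ} {c : Fin (n + 1) → ℕ → ℝ}
    (hg : ∀ k t, HasSum (fun l : ℕ => c k l * t ^ l) (g k t)) (x : Para n) (t : ℝ) :
    HasSum (fun l : ℕ => t ^ l • scale (fun k => c k l) x) (scale (fun k => g k t) x) := by
  have h : HasSum (fun (l : ℕ) (k : Fin (n + 1)) => x k * (c k l * t ^ l))
      (fun k => x k * g k t) := Pi.hasSum.2 fun k => (hg k t).mul_left (x k)
  have h2 := h.mapL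
    (PiLp.continuousLinearEquiv 2 ℝ fun _ : Fin (n + 1) => ℝ).symm.toContinuousLinearMap
  refine h2.congr_fun fun l => ?_
  ext k
  simp [scale]
  ring

/-- On a bounded set the distance of the transformed sums to their limit is at most a constant
times the distance in `A_{1,σ}` of the original sums to theirs. -/
lemma exists_norm_transform_le {g : Fin (n + 1) → ℝ → ℝ} {c : Fin (n + 1) → ℕ → ℝ}
    (hg : ∀ k t, HasSum (fun l : ℕ => c k l * t ^ l) (g k t)) (a : ℝ) {σ : ℝ} (hσ : 0 ≤ σ)
    (R : ℝ) : ∃ A : ℝ, ∀ (N : ℕ) (h : ℕ → ℝ) (Z : ℕ → Cl n), (∀ j ≤ N, |h j| ≤ 1) →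
      MemA σ (fun x => ∑ j ∈ Finset.range (N + 1), monoExp (h j • x) * Z j) →
      MemA σ (fun x : Para n => monoExp (a • x)) → ∀ x : Para n, ‖x‖ ≤ R →
      ‖∑ j ∈ Finset.range (N + 1), Z j * monoExp (scale (fun k => g k (h j)) x) -
        monoExp (scale (fun k => g k a) x)‖ ≤
      A * normA σ ((fun x => ∑ j ∈ Finset.range (N + 1), monoExp (h j • x) * Z j) -
          fun x : Para n => monoExp (a • x)) := by
  rcases Nat.eq_zero_or_pos n with rfl | hn
  · -- without imaginary units `E = 1`, and only `∑ Z_j → 1` is needed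
    refine ⟨1, fun N h Z _ hf hgA x _ => ?_⟩
    have := norm_sub_le_normA hf hgA 0
    simpa [monoExp_zero_units] using this
  · obtain ⟨K, hK0, hK⟩ := exists_norm_moment_sub_le (⟨0, hn⟩ : Fin n) hσ
    obtain ⟨B, hB0, hB⟩ := exists_norm_mulL_e_le n
    -- the disc of radius `ρ` contains all frequencies, and `ρ` dominates the growth of the moments
    set ρ : ℝ := max (max 1 |a|) K
    have h1ρ : 1 ≤ ρ := (le_max_left _ _).trans (le_max_left _ _)
    have haρ : |a| ≤ ρ := (le_max_right _ _).trans (le_max_left _ _)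
    have hKρ : K ≤ ρ := le_max_right _ _
    have hρ : 0 < ρ := one_pos.trans_le h1ρ
    set G : ℝ := ∑ k, ∑' l, ‖c k l‖ * ρ ^ l
    have hGk : ∀ k, PSBound ρ (g k) G := fun k => (psBound_of_hasSum (hg k) hρ.le).mono <|
      Finset.single_le_sum (f := fun k => ∑' l, ‖c k l‖ * ρ ^ l)
        (fun k _ => tsum_nonneg fun l => by positivity) (Finset.mem_univ k)
    have hG0 : 0 ≤ G := Finset.sum_nonneg fun k _ => tsum_nonneg fun l => by positivity
    refine ⟨‖mulL n‖ * Real.exp (n * (R * G + B * (R * G)) * B), fun N h Z hh hf hgA x hx => ?_⟩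
    have hy : ∀ k, PSBound ρ (fun t => scale (fun k => g k t) x k) (R * G) := fun k => by
      refine ((hGk k).smul hρ.le (x k)).mono ?_
      gcongr
      exact (PiLp.norm_apply_le x k).trans hx
    have hq := psBound_monoExp hρ hB hy
    have hε : 0 ≤ normA σ ((fun x => ∑ j ∈ Finset.range (N + 1), monoExp (h j • x) * Z j) -
          fun x : Para n => monoExp (a • x)) := Real.iSup_nonneg fun x => by positivity
    refine norm_sum_mul_sub_le (q := fun t => monoExp (scale (fun k => g k t) x)) hq hε
      (fun j hj => (hh j (Nat.lt_succ_iff.1 (Finset.mem_range.1 hj))).trans h1ρ) haρ fun k => ?_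
    refine (hK N a h Z hf hgA k).trans ?_
    gcongr

end Cliff

end

theorem mainTheorem4 (n : ℕ) (a : ℝ)
    (g : Fin (n + 1) → ℝ → ℝ) (c : Fin (n + 1) → ℕ → ℝ)
    (hg : ∀ k t, HasSum (fun l : ℕ => c k l * t ^ l) (g k t))
    (hg_gt : ∀ k t, 1 < |t| → 1 < |g k t|)
    (hg_le : ∀ k t, |t| ≤ 1 → |g k t| ≤ 1)
    (h : ℕ → ℕ → ℝ) (hh : ∀ N, ∀ j ≤ N, |h N j| ≤ 1)
    (Z : ℕ → ℕ → Cliff.Cl n)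
    (hconv : Cliff.ConvergesInA
      (fun N x => ∑ j ∈ Finset.range (N + 1), Cliff.monoExp (h N j • x) * Z N j)
      (fun x => Cliff.monoExp (a • x))) :
    -- `∑_l u_l(x) t^l` with `u_l(x) = ∑_k e_k x_k g_{k,l}` is `∑_k e_k x_k g_k(t)`
    (∀ (x : Cliff.Para n) (t : ℝ),
      HasSum (fun l : ℕ => t ^ l • Cliff.scale (fun k => c k l) x)
        (Cliff.scale (fun k => g k t) x)) ∧
    (∀ K : Set (Cliff.Para n), IsCompact K →
      TendstoUniformlyOn
        (fun N x => ∑ j ∈ Finset.range (N + 1),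
          Z N j * Cliff.monoExp (Cliff.scale (fun k => g k (h N j)) x))
        (fun x => Cliff.monoExp (Cliff.scale (fun k => g k a) x)) atTop K) ∧
    (1 < |a| → Cliff.IsSuperoscillating a Z (fun N j k => g k (h N j)) g) := by
  have hunif : ∀ K : Set (Cliff.Para n), IsCompact K →
      TendstoUniformlyOn
        (fun N x => ∑ j ∈ Finset.range (N + 1),
          Z N j * Cliff.monoExp (Cliff.scale (fun k => g k (h N j)) x))
        (fun x => Cliff.monoExp (Cliff.scale (fun k => g k a) x)) atTop K := by
    intro K hK
    obtain ⟨σ, hσ, hgA, hfA, hlim⟩ := hconv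
    obtain ⟨R, hR⟩ := hK.isBounded.exists_norm_le
    obtain ⟨A, hA⟩ := Cliff.exists_norm_transform_le hg a hσ.le R
    have hlim' := hlim.const_mul A
    rw [mul_zero] at hlim'
    rw [Metric.tendstoUniformlyOn_iff]
    intro δ hδ
    filter_upwards [hlim'.eventually_lt_const hδ] with N hN x hx
    rw [dist_comm, dist_eq_norm]
    exact (hA N (h N) (Z N) (hh N) (hfA N) hgA x (hR x hx)).trans_lt hN
  exact ⟨fun x t => Cliff.scale_hasSum hg x t, hunif, fun ha =>
    ⟨fun N j hj k => hg_le k _ (hh N j hj), fun k => Cliff.continuous_of_hasSum (hg k),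
      fun k => hg_gt _ _ ha, hunif⟩⟩
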